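/- Let $K$ be a positive integer, let $\gamma_0,\dots,\gamma_K$ be real numbers with $\gamma_0=1$ and $\gamma_K\neq 0$, and let $\alpha\in\mathbb Z$. Let $$L_n^{\alpha}(x)=\sum_{k=0}^n\binom{n+\alpha}{n-k}\frac{(-x)^k}{k!}$$ denote the Laguerre polynomials (with $\binom{a}{m}=a(a-1)\cdots(a-m+1)/m!$), and put $$q_n(x)=\sum_{j=0}^K\gamma_jL^{\alpha}_{n-j}(x)\quad(n\ge K),\qquad P(x)=\sum_{j=0}^K\gamma_jx^{K-j}.$$ Assume that all the complex zeros of $P$ are real. Let $s\ge 0$ be the multiplicity of $x=1$ as a zero of $P$ ($s=0$ if $P(1)\ne0$), and let $N^1$ be the number of zeros of $P$ greater than $1$, counted with multiplicity. For finite sets $U,V\subset\mathbb R$, say that $U$ strictly interlaces $V$ if $\min U<\min V$ (with $\min\emptyset=+\infty$) and between any two consecutive elements of either of the two sets there is an element of the other; say that $U$ interlaces $V$ if $U\setminus(U\cap V)$ strictly interlaces $V\setminus(U\cap V)$. Below, "the zeros of $q_{n+1}$ interlace the zeros of $q_n$" means that the set of real zeros of $q_{n+1}$ interlaces the set of real zeros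 of $q_n$. 1. Let $\alpha\ge 0$. Then for every $n\ge K$: - if $s\le\alpha$ (in particular if $P(1)\neq0$), then $q_n$ has $n$ real and simple zeros; if moreover $N^1=0$, then all of them are positive; - if $s>\alpha$, then $q_n$ has a zero at $x=0$ of multiplicity exactly $s-\alpha$, and $n+\alpha-s$ further zeros, which are real, simple and non-zero; if moreover $N^1=0$, then all these further zeros are positive; - the zeros of $q_{n+1}$ interlace the zeros of $q_n$. 2. Let $\alpha\le -1$. Then for all sufficiently large $n$, $q_n$ has a zero at $x=0$ of multiplicity exactly $-\alpha+s$, and $n+\alpha-s$ further zeros, which are real, simple and non-zero; and the zeros of $q_{n+1}$ interlace the zeros of $q_n$. 3. In all cases, for all sufficiently large $n$, $q_n$ has exactly $N^1$ negative zeros. -/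

import Mathlib

open Polynomial Filter

noncomputable section

/-- The Laguerre polynomial `L_n^α(x) = ∑_{k=0}^n binom(n+α, n-k) (-x)^k / k!`, for an arbitrary
real parameter `α`; the generalized binomial coefficient is `Ring.choose`. -/
def laguerre (α : ℝ) (n : ℕ) : ℝ[X] :=
  ∑ k ∈ Finset.range (n + 1),
    C (Ring.choose ((n : ℝ) + α) (n - k) * (-1) ^ k / (k.factorial : ℝ)) * X ^ k

/-- The combination `q_n = ∑_{j=0}^K γ_j L_{n-j}^α` of consecutive Laguerre polynomials.
It is only meaningful (and only used) for `n ≥ K`. -/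
def laguerreComb (α : ℝ) (K : ℕ) (γ : ℕ → ℝ) (n : ℕ) : ℝ[X] :=
  ∑ j ∈ Finset.range (K + 1), C (γ j) * laguerre α (n - j)

/-- The polynomial `P(x) = ∑_{j=0}^K γ_j x^{K-j}`. -/
def assocPoly (K : ℕ) (γ : ℕ → ℝ) : ℝ[X] :=
  ∑ j ∈ Finset.range (K + 1), C (γ j) * X ^ (K - j)

/-- Every complex zero of the real polynomial `p` is real. -/
def HasOnlyRealZeros (p : ℝ[X]) : Prop :=
  ∀ z : ℂ, aeval z p = 0 → z.im = 0

/-- The set of real zeros of `p` (without multiplicity; empty if `p = 0`). -/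
def realZeros (p : ℝ[X]) : Finset ℝ := p.roots.toFinset

/-- The number of real zeros of `p` greater than `1`, counted with multiplicity. -/
def numZerosGtOne (p : ℝ[X]) : ℕ := (p.roots.filter (fun x => 1 < x)).card

/-- `a < b` are consecutive elements of the finite set `S`. -/
def ConsecutiveIn (S : Finset ℝ) (a b : ℝ) : Prop :=
  a ∈ S ∧ b ∈ S ∧ a < b ∧ ∀ c ∈ S, ¬ (a < c ∧ c < b)

/-- `U` strictly interlaces `V`: `min U < min V` (where `min ∅ = +∞`), and between any two
consecutive elements of any of the two sets there is an element of the other. -/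
def StrictlyInterlaces (U V : Finset ℝ) : Prop :=
  U.min < V.min ∧
  (∀ a b, ConsecutiveIn U a b → ∃ v ∈ V, a < v ∧ v < b) ∧
  (∀ a b, ConsecutiveIn V a b → ∃ u ∈ U, a < u ∧ u < b)

/-- `U` interlaces `V`: after removing the common elements of `U` and `V`, the first set
strictly interlaces the second one. -/
def Interlaces (U V : Finset ℝ) : Prop :=
  StrictlyInterlaces (U \ (U ∩ V)) (V \ (U ∩ V))

end

noncomputable section

/-! Put D = d/dx and e_n = (-x)^n/n!, so that D e_n = -e_{n-1}. The binomial theorem gives L_n^α =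
(1-D)^(n+α) e_n once n+α ≥ 0. Homogenising P, with r running over its zeros, gives q_n = (1-D)^N ∏
(1+(r-1)D) e_n, where N = n+α-K (`laguerreComb_eq_diffOp`). The zeros r = 1 contribute trivial
factors, so n+α-s factors 1+bD with b ≠ 0 act on a monomial of degree n.

Each such factor keeps all zeros real, makes the zeros off the origin simple by the Laguerre
inequality p'^2 - pp'' > 0, and lowers the multiplicity at the origin by one while it is positive
(`SimpleOff.diffOp_factorPoly`). This gives reality, simplicity and the multiplicity at 0.

For interlacing, let A be the operator of q_n and w = A e_{n+1}. Then w' = -q_n and q_{n+1} = w -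
w', so the Wronskian of q_n and q_{n+1} is the negative of the Laguerre expression of w
(`interlaces_sub_derivative`).

Factors with b < 0 create no negative zeros from nonnegative ones, and each b > 0 creates at most
one; the positive zeros are bounded symmetrically. If there are at most n factors, the number of
nonzero zeros forces equality. Otherwise one descends by differentiation from the degree equal to
the number of factors. No negative zero is lost if the top coefficients of the symbol alternate in
sign, which a large power of 1-x guarantees. -/

/-! ### Real-rootedness of p + b p' and the Laguerre inequality -/

/-- For a nonconstant real polynomial with only real zeros, the imaginary part of the logarithmic
derivative at a nonreal `z` has the sign opposite to that of `z.im`. -/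
theorem im_derivative_mul_conj (m : Multiset ℝ) (z : ℂ) :
    ∃ S : ℝ, ((aeval z (derivative (m.map fun r => X - C r).prod)) *
      (starRingEnd ℂ) (aeval z (m.map fun r => X - C r).prod)).im = -z.im * S ∧ 0 ≤ S ∧
      (z.im ≠ 0 → m ≠ 0 → 0 < S) := by
  induction m using Multiset.induction_on with
  | empty => exact ⟨0, by simp⟩
  | cons r m ih =>
    obtain ⟨S, hS, hS0, hS1⟩ := ih
    have hne : z.im ≠ 0 → aeval z (m.map fun r => X - C r).prod ≠ 0 := by
      intro hz h
      rw [map_multiset_prod, Multiset.map_map, Multiset.prod_eq_zero_iff] at h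
      obtain ⟨t, -, ht⟩ := Multiset.mem_map.1 h
      apply hz
      have : z - (t : ℂ) = 0 := by simpa using ht
      simpa using congrArg Complex.im this
    set q := (m.map fun r => X - C r).prod with hq
    -- By the product rule, multiplying q by z - r turns q' q̄ into |q|^2 times the conjugate of z -
    -- r, plus |z-r|^2 q' q̄.
    refine ⟨Complex.normSq (aeval z q) + Complex.normSq (z - r) * S, ?_, ?_, ?_⟩
    · have : aeval z (derivative ((X - C r) * q)) * (starRingEnd ℂ) (aeval z ((X - C r) * q)) =
        (Complex.normSq (aeval z q) : ℂ) * (starRingEnd ℂ) (z - r) +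
        (Complex.normSq (z - r) : ℂ) * (aeval z (derivative q) * (starRingEnd ℂ) (aeval z q)) := by
        rw [← Complex.mul_conj, ← Complex.mul_conj]
        simp [derivative_mul]
        ring
      rw [Multiset.map_cons, Multiset.prod_cons, this, Complex.add_im, Complex.im_ofReal_mul,
        Complex.im_ofReal_mul, hS]
      simp
      ring
    · exact add_nonneg (Complex.normSq_nonneg _) (mul_nonneg (Complex.normSq_nonneg _) hS0)
    · intro hz _
      exact add_pos_of_pos_of_nonneg (Complex.normSq_pos.2 (hne hz))
        (mul_nonneg (Complex.normSq_nonneg _) hS0)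

theorem splits_of_hasOnlyRealZeros {p : ℝ[X]} (h : HasOnlyRealZeros p) : p.Splits := by
  by_cases hp : p = 0
  · subst hp; exact Splits.zero
  refine Splits.of_splits_map (algebraMap ℝ ℂ) (IsAlgClosed.splits _) ?_
  intro z hz
  have : aeval z p = 0 := by
    rw [mem_roots'] at hz
    simpa [IsRoot, eval_map_algebraMap] using hz.2
  exact ⟨z.re, by apply Complex.ext <;> simp [h z this]⟩

/-- At a nonreal zero, p = -b p', so p' times the conjugate of p would be real, against
`im_derivative_mul_conj`. -/
theorem splits_add_C_mul_derivative {p : ℝ[X]} (hp : p.Splits) (b : ℝ) :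
    (p + C b * derivative p).Splits := by
  by_cases hd : p.natDegree = 0
  · rw [derivative_of_natDegree_zero hd]; simpa using hp
  apply splits_of_hasOnlyRealZeros
  intro z hz
  by_contra hzi
  have hp0 : p ≠ 0 := by rintro rfl; simp at hd
  obtain ⟨S, hS, -, hpos⟩ := im_derivative_mul_conj p.roots z
  have hr : p.roots ≠ 0 := hp.roots_ne_zero hd
  have hlc : p.leadingCoeff ≠ 0 := leadingCoeff_ne_zero.2 hp0
  have hpe := hp.eq_prod_roots
  set q := (p.roots.map fun r => X - C r).prod with hq
  have h1 : aeval z p = p.leadingCoeff * aeval z q := by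
    conv_lhs => rw [hpe]
    simp
  have h2 : aeval z (derivative p) = p.leadingCoeff * aeval z (derivative q) := by
    conv_lhs => rw [hpe]
    simp
  rw [map_add, map_mul, h1, h2] at hz
  have h3 : aeval z q = - b * aeval z (derivative q) := by
    have : (p.leadingCoeff : ℂ) ≠ 0 := by exact_mod_cast hlc
    apply mul_left_cancel₀ this
    simp only [aeval_C, Complex.coe_algebraMap] at hz
    linear_combination hz
  rw [h3, map_mul, mul_left_comm, Complex.mul_conj, map_neg, Complex.conj_ofReal] at hS
  have : -z.im * S = 0 := by rw [← hS]; norm_cast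
  have hS' := hpos hzi hr
  rcases mul_eq_zero.1 this with h | h
  · exact hzi (by linarith)
  · linarith

/-- The Laguerre inequality for polynomials with only real zeros. -/
theorem laguerre_inequality_aux (m : Multiset ℝ) (x : ℝ) :
    let q := (m.map fun r => X - C r).prod
    0 ≤ (derivative q).eval x ^ 2 - q.eval x * (derivative (derivative q)).eval x ∧
    (m ≠ 0 → q.eval x ≠ 0 →
      0 < (derivative q).eval x ^ 2 - q.eval x * (derivative (derivative q)).eval x) := by
  induction m using Multiset.induction_on with
  | empty => simp
  | cons r m ih =>
    intro q
    simp only at ih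
    set q' := (m.map fun r => X - C r).prod with hq'
    have hq : q = (X - C r) * q' := by simp [q, q']
    have : (derivative q).eval x ^ 2 - q.eval x * (derivative (derivative q)).eval x =
      (x - r) ^ 2 * ((derivative q').eval x ^ 2 - q'.eval x * (derivative (derivative q')).eval x)
        + q'.eval x ^ 2 := by
      rw [hq]; simp [derivative_mul]; ring
    rw [this]
    have h0 := mul_nonneg (sq_nonneg (x - r)) ih.1
    refine ⟨by positivity, fun _ hx => ?_⟩
    have : q'.eval x ≠ 0 := by
      intro h; apply hx; rw [hq]; simp [h]
    positivity

/-- Off the zeros this is the strict form of `laguerre_inequality_aux`; at a simple zero only p'^2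
remains. Multiple zeros must be excluded, since the expression vanishes there. -/
theorem laguerre_inequality {p : ℝ[X]} (hp : p.Splits) (hd : p.natDegree ≠ 0) {x : ℝ}
    (hx : p.eval x = 0 → (derivative p).eval x ≠ 0) :
    0 < (derivative p).eval x ^ 2 - p.eval x * (derivative (derivative p)).eval x := by
  by_cases h : p.eval x = 0
  · have := hx h
    rw [h]; simp only [zero_mul, sub_zero]; positivity
  · have hpe := hp.eq_prod_roots
    have h1 := (laguerre_inequality_aux p.roots x).2 (hp.roots_ne_zero hd)
    set q := (p.roots.map fun r => X - C r).prod with hq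
    have hp0 : p ≠ 0 := by rintro rfl; simp at hd
    have hlc : p.leadingCoeff ≠ 0 := leadingCoeff_ne_zero.2 hp0
    set c := p.leadingCoeff
    have hq0 : q.eval x ≠ 0 := by intro h'; apply h; rw [hpe]; simp [h']
    have h2 := h1 hq0
    have h3 : (derivative p).eval x ^ 2 - p.eval x * (derivative (derivative p)).eval x =
      c ^ 2 * ((derivative q).eval x ^ 2 - q.eval x * (derivative (derivative q)).eval x) := by
      rw [hpe]; simp; ring
    rw [h3]; positivity

/-- The logarithmic derivative has a constant sign on the side of the zeros. -/
theorem eval_mul_eval_derivative_sign {p : ℝ[X]} (hp : p.Splits) {ε x : ℝ}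
    (h : ∀ r ∈ p.roots, 0 < ε * (r - x)) :
    ε * (p.eval x * (derivative p).eval x) ≤ 0 := by
  have key : ∀ m : Multiset ℝ, (∀ r ∈ m, 0 < ε * (r - x)) →
      ε * ((m.map fun r => X - C r).prod.eval x *
        (derivative (m.map fun r => X - C r).prod).eval x) ≤ 0 := by
    intro m
    induction m using Multiset.induction_on with
    | empty => simp
    | cons r m ih =>
      intro hm
      have h1 := ih fun t ht => hm t (Multiset.mem_cons_of_mem ht)
      have h2 := hm r (Multiset.mem_cons_self _ _)
      rw [Multiset.map_cons, Multiset.prod_cons]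
      set q := (m.map fun r => X - C r).prod
      have : ε * (((X - C r) * q).eval x * (derivative ((X - C r) * q)).eval x) =
        -(ε * (r - x) * q.eval x ^ 2) + (x - r) ^ 2 *
          (ε * (q.eval x * (derivative q).eval x)) := by
        simp [derivative_mul]; ring
      rw [this]
      have h3 : 0 ≤ ε * (r - x) * q.eval x ^ 2 := mul_nonneg h2.le (sq_nonneg _)
      have h4 := mul_nonpos_of_nonneg_of_nonpos (sq_nonneg (x - r)) h1
      linarith
  have h1 := key _ h
  have hpe := hp.eq_prod_roots
  set q := (p.roots.map fun r => X - C r).prod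
  have : ε * (p.eval x * (derivative p).eval x) =
      p.leadingCoeff ^ 2 * (ε * (q.eval x * (derivative q).eval x)) := by
    conv_lhs => rw [hpe]
    simp; ring
  rw [this]
  exact mul_nonpos_of_nonneg_of_nonpos (sq_nonneg _) h1

theorem natDegree_add_C_mul_derivative (p : ℝ[X]) (b : ℝ) :
    (p + C b * derivative p).natDegree = p.natDegree := by
  by_cases hd : p.natDegree = 0
  · rw [derivative_of_natDegree_zero hd]; simp
  · apply natDegree_add_eq_left_of_natDegree_lt
    exact (natDegree_C_mul_le _ _).trans_lt (natDegree_derivative_lt hd)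

theorem add_C_mul_derivative_ne_zero {p : ℝ[X]} (hp : p ≠ 0) (b : ℝ) :
    p + C b * derivative p ≠ 0 := by
  by_cases hd : p.natDegree = 0
  · rw [derivative_of_natDegree_zero hd]; simpa using hp
  · intro h
    have := natDegree_add_C_mul_derivative p b
    rw [h] at this; simp at this; omega

/-! ### Simplicity of zeros away from the origin -/

theorem rootMultiplicity_le_one_iff {p : ℝ[X]} (hp : p ≠ 0) (x : ℝ) :
    p.rootMultiplicity x ≤ 1 ↔ (p.eval x = 0 → (derivative p).eval x ≠ 0) := by
  rw [← not_lt, one_lt_rootMultiplicity_iff_isRoot hp]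
  simp [IsRoot]

/-- A polynomial with only real zeros, all of them simple except for a zero at the origin of
multiplicity `μ` (which, for `μ = 0`, may also be simple). -/
structure SimpleOff (μ : ℕ) (p : ℝ[X]) : Prop where
  splits : p.Splits
  ne_zero : p ≠ 0
  simple : ∀ x ≠ 0, p.rootMultiplicity x ≤ 1
  mult : p.rootMultiplicity 0 = μ ∨ (μ = 0 ∧ p.rootMultiplicity 0 ≤ 1)

/-- Writing p = x^(k+1) W leaves x^k times a cofactor whose value at 0 is b(k+1)W(0) ≠ 0. -/
theorem rootMultiplicity_zero_add_C_mul_derivative {p : ℝ[X]} (hp : p ≠ 0) {b : ℝ} (hb : b ≠ 0)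
    (h : p.rootMultiplicity 0 ≠ 0) :
    (p + C b * derivative p).rootMultiplicity 0 = p.rootMultiplicity 0 - 1 := by
  obtain ⟨k, hk⟩ : ∃ k, p.rootMultiplicity 0 = k + 1 := Nat.exists_eq_succ_of_ne_zero h
  obtain ⟨W, hW, hW0⟩ := exists_eq_pow_rootMultiplicity_mul_and_not_dvd p hp 0
  rw [hk] at hW ⊢
  simp only [C_0, sub_zero] at hW hW0
  rw [X_dvd_iff, coeff_zero_eq_eval_zero] at hW0
  have h1 : p + C b * derivative p =
      (X * W + C (b * (k + 1)) * W + C b * X * derivative W) * (X - C 0) ^ k := by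
    rw [hW]
    simp [derivative_mul]
    ring
  rw [h1]
  have h2 : (X * W + C (b * (k + 1)) * W + C b * X * derivative W).eval 0 ≠ 0 := by
    have : (k : ℝ) + 1 ≠ 0 := by positivity
    simp [hb, this, hW0]
  rw [rootMultiplicity_mul_X_sub_C_pow, rootMultiplicity_eq_zero h2]
  · simp
  · intro h; rw [h] at h2; simp at h2

theorem SimpleOff.laguerre_pos {μ : ℕ} {p : ℝ[X]} (h : SimpleOff μ p) (hd : p.natDegree ≠ 0)
    {x : ℝ} (hx : x ≠ 0 ∨ μ ≤ 1) :
    0 < (derivative p).eval x ^ 2 - p.eval x * (derivative (derivative p)).eval x := by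
  apply laguerre_inequality h.splits hd
  rw [← rootMultiplicity_le_one_iff h.ne_zero]
  by_cases hx0 : x = 0
  · subst hx0
    have := h.mult
    have := hx.resolve_left (by simp)
    omega
  · exact h.simple x hx0

/-- A multiple zero of p + bp' would satisfy p = -bp' and p' = -bp'', hence p'^2 - pp'' = 0, against
the Laguerre inequality. For μ ≤ 1 the same argument covers the origin. -/
theorem SimpleOff.add_C_mul_derivative {μ : ℕ} {p : ℝ[X]} (h : SimpleOff μ p) {b : ℝ}
    (hb : b ≠ 0) : SimpleOff (μ - 1) (p + C b * derivative p) := by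
  have hne := add_C_mul_derivative_ne_zero h.ne_zero b
  have key : ∀ x, (x ≠ 0 ∨ μ ≤ 1) → (p + C b * derivative p).rootMultiplicity x ≤ 1 := by
    intro x hx
    by_cases hd : p.natDegree = 0
    · rw [rootMultiplicity_le_one_iff hne]
      intro h1
      rw [eq_C_of_natDegree_eq_zero hd] at h1
      have := h.ne_zero
      rw [eq_C_of_natDegree_eq_zero hd] at this
      simp at this h1
      exact absurd h1 this
    · have hL := h.laguerre_pos hd hx
      rw [rootMultiplicity_le_one_iff hne]
      intro h1 h2
      simp at h1 h2
      have : (derivative p).eval x ^ 2 - p.eval x * (derivative (derivative p)).eval x = 0 := by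
        apply mul_left_cancel₀ hb
        linear_combination (derivative p).eval x * h1 - p.eval x * h2
      linarith
  refine ⟨splits_add_C_mul_derivative h.splits b, hne, fun x hx => key x (Or.inl hx), ?_⟩
  by_cases hm : p.rootMultiplicity 0 = 0
  · have hμ : μ = 0 := by have := h.mult; omega
    exact Or.inr ⟨by omega, key 0 (Or.inr (by omega))⟩
  · rw [rootMultiplicity_zero_add_C_mul_derivative h.ne_zero hb hm]
    have := h.mult
    omega

/-! ### Preservation of the sign of the zeros -/

/-- For `ε b ≤ 0`, `p + b p'` has no zero on the side of the zeros of `p` selected by `ε`. -/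
theorem eval_add_C_mul_derivative_ne_zero {p : ℝ[X]} (hp : p.Splits) {ε b x : ℝ}
    (hε : ε ^ 2 = 1) (hb : ε * b ≤ 0) (h : ∀ r ∈ p.roots, 0 < ε * (r - x)) (hp0 : p ≠ 0) :
    (p + C b * derivative p).eval x ≠ 0 := by
  intro h1
  have hx : p.eval x ≠ 0 := by
    intro hx
    have := h x ((mem_roots hp0).2 hx)
    simp at this
  have h2 := eval_mul_eval_derivative_sign hp h
  simp at h1
  have h3 : p.eval x ^ 2 + (ε * b) * (ε * (p.eval x * (derivative p).eval x)) = 0 := by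
    linear_combination (p.eval x) * h1 + b * (p.eval x * (derivative p).eval x) * hε
  have h4 := mul_nonneg_of_nonpos_of_nonpos hb h2
  have : 0 < p.eval x ^ 2 := by positivity
  linarith

/-- If all zeros `r` of `p` satisfy `0 ≤ ε r` then so do those of `p + b p'`, when `ε b ≤ 0`. -/
theorem roots_nonneg_add_C_mul_derivative {p : ℝ[X]} (hp : p.Splits) (hp0 : p ≠ 0) {ε b : ℝ}
    (hε : ε ^ 2 = 1) (hb : ε * b ≤ 0) (h : ∀ r ∈ p.roots, 0 ≤ ε * r) :
    ∀ r ∈ (p + C b * derivative p).roots, 0 ≤ ε * r := by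
  intro r hr
  by_contra! hlt
  refine eval_add_C_mul_derivative_ne_zero hp hε hb (fun t ht => ?_) hp0 ((mem_roots'.1 hr).2)
  have := h t ht
  linarith

theorem roots_pos_add_C_mul_derivative {p : ℝ[X]} (hp : p.Splits) (hp0 : p ≠ 0) {ε b : ℝ}
    (hε : ε ^ 2 = 1) (hb : ε * b ≤ 0) (h : ∀ r ∈ p.roots, 0 < ε * r) :
    ∀ r ∈ (p + C b * derivative p).roots, 0 < ε * r := by
  intro r hr
  by_contra! hlt
  refine eval_add_C_mul_derivative_ne_zero hp hε hb (fun t ht => ?_) hp0 ((mem_roots'.1 hr).2)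
  have := h t ht
  linarith

/-! ### Interlacing from the sign of a Wronskian -/

theorem mem_realZeros {p : ℝ[X]} (hp : p ≠ 0) {x : ℝ} : x ∈ realZeros p ↔ p.eval x = 0 := by
  simp [realZeros, hp]

theorem exists_eval_eq_zero_of_mul_neg {p : ℝ[X]} {x y : ℝ} (hxy : x < y)
    (h : p.eval x * p.eval y < 0) : ∃ z, x < z ∧ z < y ∧ p.eval z = 0 := by
  have hc : ContinuousOn (fun t => p.eval t) (Set.Icc x y) := p.continuous.continuousOn
  rcases mul_neg_iff.1 h with ⟨h1, h2⟩ | ⟨h1, h2⟩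
  · obtain ⟨z, hz, hz0⟩ := intermediate_value_Ioo' hxy.le hc ⟨h2, h1⟩
    exact ⟨z, hz.1, hz.2, hz0⟩
  · obtain ⟨z, hz, hz0⟩ := intermediate_value_Ioo hxy.le hc ⟨h1, h2⟩
    exact ⟨z, hz.1, hz.2, hz0⟩

/-- At consecutive zeros of a polynomial, its derivative does not have the same strict sign. -/
theorem eval_derivative_mul_nonpos {p : ℝ[X]} {x y : ℝ} (hxy : x < y) (hx : p.eval x = 0)
    (hy : p.eval y = 0) (h : ∀ z, x < z → z < y → p.eval z ≠ 0) :
    (derivative p).eval x * (derivative p).eval y ≤ 0 := by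
  obtain ⟨q, hq⟩ := dvd_iff_isRoot.2 (show p.IsRoot x from hx)
  have hqy : q.eval y = 0 := by
    rw [hq] at hy
    simp only [eval_mul, eval_sub, eval_X, eval_C, mul_eq_zero] at hy
    exact hy.resolve_left (sub_ne_zero.2 hxy.ne')
  obtain ⟨H, hH⟩ := dvd_iff_isRoot.2 (show q.IsRoot y from hqy)
  -- With p(t) = (t-x)(t-y)H(t), the derivatives at x and y are (x-y)H(x) and (y-x)H(y), and H has
  -- no zero in between.
  have e : (derivative p).eval x * (derivative p).eval y =
      -((y - x) ^ 2 * (H.eval x * H.eval y)) := by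
    rw [hq, hH]; simp [derivative_mul]; ring
  rw [e]
  by_contra! hcon
  have h1 : H.eval x * H.eval y < 0 := by
    by_contra! h2
    have := mul_nonneg (sq_nonneg (y - x)) h2
    linarith
  obtain ⟨z, h3, h4, h5⟩ := exists_eval_eq_zero_of_mul_neg hxy h1
  exact h z h3 h4 (by rw [hq, hH]; simp [h5])

/-- Between consecutive zeros of `p` at which the Wronskian of `p` and `r` has a fixed strict
sign there is a zero of `r`. -/
theorem exists_zero_between {p r : ℝ[X]} {x y σ : ℝ} (hxy : x < y) (hx : p.eval x = 0)
    (hy : p.eval y = 0) (h : ∀ z, x < z → z < y → p.eval z ≠ 0)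
    (h1 : 0 < σ * ((derivative p).eval x * r.eval x))
    (h2 : 0 < σ * ((derivative p).eval y * r.eval y)) :
    ∃ z, x < z ∧ z < y ∧ r.eval z = 0 := by
  apply exists_eval_eq_zero_of_mul_neg hxy
  have h3 := eval_derivative_mul_nonpos hxy hx hy h
  have h4 := mul_pos h1 h2
  by_contra! h5
  have h6 : σ * ((derivative p).eval x * r.eval x) * (σ * ((derivative p).eval y * r.eval y)) =
    σ ^ 2 * (((derivative p).eval x * (derivative p).eval y) * (r.eval x * r.eval y)) := by ring
  have h7 := mul_nonpos_of_nonneg_of_nonpos (sq_nonneg σ) (mul_nonpos_of_nonpos_of_nonneg h3 h5)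
  linarith

/-- A Wronskian criterion for strict interlacing. -/
theorem strictlyInterlaces_of_wronskian {F G : ℝ[X]} (hF : F ≠ 0) (hG : G ≠ 0)
    (hcard : (realZeros G).card = (realZeros F).card + 1)
    (hW : ∀ x, F.eval x = 0 ∨ G.eval x = 0 →
      F.eval x * (derivative G).eval x - (derivative F).eval x * G.eval x < 0) :
    StrictlyInterlaces (realZeros G) (realZeros F) := by
  have hGF : ∀ x y, x ∈ realZeros G → y ∈ realZeros G → x < y →
      (∀ z ∈ realZeros G, ¬ (x < z ∧ z < y)) → ∃ z ∈ realZeros F, x < z ∧ z < y := by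
    intro x y hx hy hxy hz
    simp only [mem_realZeros hF, mem_realZeros hG] at *
    obtain ⟨z, h1, h2, h3⟩ := exists_zero_between (r := F) (σ := -1) hxy hx hy
      (fun z h1 h2 h3 => hz z h3 ⟨h1, h2⟩)
      (by have := hW x (Or.inr hx); rw [hx] at this; linarith)
      (by have := hW y (Or.inr hy); rw [hy] at this; linarith)
    exact ⟨z, h3, h1, h2⟩
  refine ⟨?_, ?_, ?_⟩
  · have hne : (realZeros G).Nonempty := by
      rw [← Finset.card_pos]; omega
    set m := (realZeros G).min' hne with hm
    have hmm : m ∈ realZeros G := Finset.min'_mem _ _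
    -- The gaps of G already contain card G - 1 = card F zeros of F, all larger than m, so no zero
    -- of F lies at or below m.
    have h1 := Finset.card_le_of_interleaved (s := realZeros G)
      (t := (realZeros F).filter (m < ·)) (by
        intro x hx y hy hxy hz
        obtain ⟨z, h1, h2, h3⟩ := hGF x y hx hy hxy (fun z hz' => by simpa using hz z hz')
        have : m ≤ x := Finset.min'_le _ _ hx
        exact ⟨z, by simp [h1]; linarith, h2, h3⟩)
    have h2 : (realZeros F).filter (m < ·) = realZeros F :=
      Finset.eq_of_subset_of_card_le (Finset.filter_subset _ _) (by omega)
    rw [← Finset.coe_min' hne]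
    rcases (realZeros F).eq_empty_or_nonempty with he | he
    · rw [he]; exact WithTop.coe_lt_top _
    · rw [← Finset.coe_min' he]
      have : (realZeros F).min' he ∈ realZeros F := Finset.min'_mem _ _
      have h3 := Finset.mem_filter.1 (h2.symm ▸ this :
        (realZeros F).min' he ∈ (realZeros F).filter (m < ·))
      exact WithTop.coe_lt_coe.2 h3.2
  · rintro a b ⟨ha, hb, hab, hc⟩
    exact hGF a b ha hb hab hc
  · rintro x y ⟨hx, hy, hxy, hz⟩
    simp only [mem_realZeros hF, mem_realZeros hG] at *
    obtain ⟨z, h1, h2, h3⟩ := exists_zero_between (r := G) (σ := 1) hxy hx hy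
      (fun z h1 h2 h3 => hz z h3 ⟨h1, h2⟩)
      (by have := hW x (Or.inl hx); rw [hx] at this; linarith)
      (by have := hW y (Or.inl hy); rw [hy] at this; linarith)
    exact ⟨z, h3, h1, h2⟩

namespace SimpleOff

variable {μ : ℕ} {p : ℝ[X]}

theorem card_realZeros (h : SimpleOff 0 p) : (realZeros p).card = p.natDegree := by
  rw [h.splits.natDegree_eq_card_roots, realZeros, Multiset.toFinset_card_of_nodup]
  rw [Multiset.nodup_iff_count_le_one]
  intro x
  rw [count_roots]
  by_cases hx : x = 0
  · subst hx; have := h.mult; omega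
  · exact h.simple x hx

theorem card_realZeros_erase (h : SimpleOff μ p) :
    ((realZeros p).erase 0).card + p.rootMultiplicity 0 = p.natDegree := by
  rw [h.splits.natDegree_eq_card_roots, ← count_roots,
    ← congrArg Multiset.card (Multiset.filter_add_not (p := fun x : ℝ => x ≠ 0) p.roots), Multiset.card_add]
  congr 1
  · rw [← Multiset.toFinset_card_of_nodup]
    · congr 1
      ext x
      simp [realZeros, and_comm]
    · refine Multiset.nodup_iff_count_le_one.2 fun x => ?_
      by_cases hx : x = 0
      · rw [Multiset.count_filter_of_neg (by simpa using hx)]; simp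
      · rw [Multiset.count_filter_of_pos (p := fun x : ℝ => x ≠ 0) hx, count_roots]
        exact h.simple x hx
  · rw [Multiset.count_eq_card_filter_eq]
    exact congrArg _ (Multiset.filter_congr fun x _ => by simp [eq_comm])

theorem rootMultiplicity_eq_one (h : SimpleOff μ p) {x : ℝ} (hx : x ≠ 0 ∨ μ = 0)
    (hx' : x ∈ realZeros p) : p.rootMultiplicity x = 1 := by
  have h1 : 0 < p.rootMultiplicity x :=
    (rootMultiplicity_pos h.ne_zero).2 ((mem_realZeros h.ne_zero).1 hx')
  by_cases hx0 : x = 0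
  · subst hx0
    have := h.mult
    have := hx.resolve_left (by simp)
    omega
  · have := h.simple x hx0
    omega

end SimpleOff

/-- Passing from `w` to `w'` and `w - w'` yields interlacing zeros. -/
theorem interlaces_sub_derivative {μ : ℕ} {w f : ℝ[X]} (hw : SimpleOff (μ + 1) w ∨ (μ = 0 ∧ SimpleOff 0 w))
    (hfw : derivative w = -f) (hf : SimpleOff μ f) (hg : SimpleOff μ (w + f))
    (hwd : w.natDegree = f.natDegree + 1) :
    Interlaces (realZeros (w + f)) (realZeros f) := by
  have hgd : (w + f).natDegree = f.natDegree + 1 := by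
    rw [natDegree_add_eq_left_of_natDegree_lt (by omega), hwd]
  -- Since w' = -f, this Wronskian equals -(w'^2 - w w'').
  have hQ : ∀ x, x ≠ 0 ∨ μ = 0 →
      f.eval x * (derivative (w + f)).eval x - (derivative f).eval x * (w + f).eval x < 0 := by
    intro x hx
    have : 0 < (derivative w).eval x ^ 2 - w.eval x * (derivative (derivative w)).eval x := by
      rcases hw with hw | ⟨-, hw⟩
      · exact hw.laguerre_pos (by omega) (hx.imp_right (by omega))
      · exact hw.laguerre_pos (by omega) (Or.inr (by omega))
    rw [hfw] at this
    simp [hfw] at this ⊢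
    linarith
  have hdisj : ∀ x, x ≠ 0 ∨ μ = 0 → f.eval x = 0 → (w + f).eval x ≠ 0 := by
    intro x hx h1 h2
    have := hQ x hx
    rw [h1, h2] at this
    simp at this
  by_cases hμ : μ = 0
  · subst hμ
    have hd : realZeros (w + f) ∩ realZeros f = ∅ := by
      ext x
      simp only [Finset.mem_inter, mem_realZeros hg.ne_zero, mem_realZeros hf.ne_zero,
        Finset.notMem_empty, iff_false]
      exact fun h => hdisj x (Or.inr rfl) h.2 h.1
    rw [Interlaces, hd, Finset.sdiff_empty, Finset.sdiff_empty]
    apply strictlyInterlaces_of_wronskian hf.ne_zero hg.ne_zero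
    · rw [hg.card_realZeros, hf.card_realZeros, hgd]
    · exact fun x _ => hQ x (Or.inr rfl)
  · have hfm : f.rootMultiplicity 0 = μ := by have := hf.mult; omega
    have hgm : (w + f).rootMultiplicity 0 = μ := by have := hg.mult; omega
    obtain ⟨F, hF, hF0⟩ := exists_eq_pow_rootMultiplicity_mul_and_not_dvd f hf.ne_zero 0
    obtain ⟨G, hG, hG0⟩ := exists_eq_pow_rootMultiplicity_mul_and_not_dvd (w + f) hg.ne_zero 0
    rw [hfm] at hF
    rw [hgm] at hG
    simp only [C_0, sub_zero, X_dvd_iff, coeff_zero_eq_eval_zero] at hF hG hF0 hG0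
    have hFn : F ≠ 0 := by rintro rfl; simp at hF0
    have hGn : G ≠ 0 := by rintro rfl; simp at hG0
    have hFz : realZeros F = (realZeros f).erase 0 := by
      ext x
      rw [Finset.mem_erase, mem_realZeros hFn, mem_realZeros hf.ne_zero, hF]
      by_cases hx : x = 0
      · subst hx; simp [hF0]
      · simp [hx]
    have hGz : realZeros G = (realZeros (w + f)).erase 0 := by
      ext x
      rw [Finset.mem_erase, mem_realZeros hGn, mem_realZeros hg.ne_zero, hG]
      by_cases hx : x = 0
      · subst hx; simp [hG0]
      · simp [hx]
    have h0f : f.eval 0 = 0 := by rw [hF]; simp [hμ]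
    have h0g : (w + f).eval 0 = 0 := by rw [hG]; simp [hμ]
    have hd : realZeros (w + f) ∩ realZeros f = {0} := by
      ext x
      simp only [Finset.mem_inter, mem_realZeros hg.ne_zero, mem_realZeros hf.ne_zero,
        Finset.mem_singleton]
      constructor
      · intro h
        by_contra hx
        exact hdisj x (Or.inl hx) h.2 h.1
      · rintro rfl; exact ⟨h0g, h0f⟩
    rw [Interlaces, hd, Finset.sdiff_singleton_eq_erase, Finset.sdiff_singleton_eq_erase,
      ← hFz, ← hGz]
    apply strictlyInterlaces_of_wronskian hFn hGn
    · rw [hFz, hGz]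
      have h1 := hf.card_realZeros_erase
      have h2 := hg.card_realZeros_erase
      omega
    · intro x hx
      have hx0 : x ≠ 0 := by
        rintro rfl
        rcases hx with h | h
        · exact hF0 h
        · exact hG0 h
      have h1 := hQ x (Or.inl hx0)
      -- A common factor x^μ only multiplies the Wronskian by x^(2μ), so its sign passes to the
      -- cofactors.
      have h2 : f.eval x * (derivative (w + f)).eval x - (derivative f).eval x * (w + f).eval x =
          (x ^ μ) ^ 2 * (F.eval x * (derivative G).eval x - (derivative F).eval x * G.eval x) := by
        rw [hG, hF]
        simp [derivative_mul]
        ring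
      rw [h2] at h1
      by_contra! h3
      have := mul_nonneg (sq_nonneg (x ^ μ)) h3
      linarith

/-! ### Counting zeros on a half-line -/

/-- On a half-line that avoids the origin, `p + b p'` has at most one zero more than `p`. -/
theorem card_filter_add_C_mul_derivative_le {μ : ℕ} {p : ℝ[X]} (h : SimpleOff μ p) {b : ℝ}
    (hb : b ≠ 0) (I : ℝ → Prop) [DecidablePred I] (hI0 : ∀ x, I x → x ≠ 0)
    (hI : ∀ x y z, I x → I y → x < z → z < y → I z) :
    ((realZeros (p + C b * derivative p)).filter I).card ≤
      ((realZeros p).filter I).card + 1 := by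
  by_cases hd : p.natDegree = 0
  · rw [derivative_of_natDegree_zero hd]; simp
  have hne := add_C_mul_derivative_ne_zero h.ne_zero b
  -- Substituting p = -bp' turns the product into b^2 times the Laguerre expression.
  have hQ : ∀ x, I x → (p + C b * derivative p).eval x = 0 →
      0 < (-b) * ((derivative (p + C b * derivative p)).eval x * p.eval x) := by
    intro x hx h0
    have h1 := h.laguerre_pos hd (Or.inl (hI0 x hx))
    have h2 : (-b) * ((derivative (p + C b * derivative p)).eval x * p.eval x) =
      b ^ 2 * ((derivative p).eval x ^ 2 - p.eval x * (derivative (derivative p)).eval x) := by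
      simp at h0 ⊢
      linear_combination (-b * (derivative p).eval x) * h0
    rw [h2]
    positivity
  apply Finset.card_le_of_interleaved
  intro x hx y hy hxy hz
  simp only [Finset.mem_filter, mem_realZeros hne, mem_realZeros h.ne_zero, Set.mem_Ioo] at *
  obtain ⟨z, h1, h2, h3⟩ := exists_zero_between (r := p) hxy hx.1 hy.1
    (fun z h1 h2 h3 => hz z ⟨h3, hI x y z hx.2 hy.2 h1 h2⟩ ⟨h1, h2⟩)
    (hQ x hx.2 hx.1) (hQ y hy.2 hy.1)
  exact ⟨z, ⟨h3, hI x y z hx.2 hy.2 h1 h2⟩, h1, h2⟩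

/-- Differentiation does not lose negative zeros if `p p'` is negative at the origin. -/
theorem card_neg_realZeros_le_derivative {p : ℝ[X]}
    (h : p.eval 0 * (derivative p).eval 0 < 0) :
    ((realZeros p).filter (· < 0)).card ≤ ((realZeros (derivative p)).filter (· < 0)).card := by
  have hp : p ≠ 0 := by rintro rfl; simp at h
  have hp' : derivative p ≠ 0 := by intro h'; rw [h'] at h; simp at h
  have h0 : (0 : ℝ) ∉ (realZeros p).filter (· < 0) := by simp
  -- Adjoining 0 makes up for the zero lost in Rolle's theorem: p' also vanishes between the last
  -- negative zero of p and 0.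
  have key := Finset.card_le_of_interleaved (s := insert 0 ((realZeros p).filter (· < 0)))
    (t := (realZeros (derivative p)).filter (· < 0)) (by
      intro x hx y hy hxy _
      simp only [Finset.mem_insert, Finset.mem_filter, mem_realZeros hp, mem_realZeros hp'] at *
      have hx0 : x < 0 := by
        rcases hx with rfl | hx
        · rcases hy with rfl | hy
          · exact hxy
          · linarith [hy.2]
        · exact hx.2
      have hpx : p.eval x = 0 := by
        rcases hx with rfl | hx
        · simp at hx0
        · exact hx.1
      rcases hy with rfl | hy
      -- The slope p'(c) has the sign of p(0), opposite to that of p'(0), so p' changes sign on (c,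
      -- 0).
      · obtain ⟨c, hc, hc'⟩ := exists_deriv_eq_slope (fun t => p.eval t) hxy
          p.continuous.continuousOn p.differentiable.differentiableOn
        rw [Polynomial.deriv, eq_div_iff (by linarith)] at hc'
        obtain ⟨z, h1, h2, h3⟩ := exists_eval_eq_zero_of_mul_neg (p := derivative p) hc.2 (by
          by_contra! h1
          rw [hpx, sub_zero] at hc'
          rw [← hc'] at h
          have : 0 ≤ (derivative p).eval c * (derivative p).eval 0 * (0 - x) :=
            mul_nonneg h1 (by linarith)
          linarith)
        exact ⟨z, ⟨h3, h2⟩, hc.1.trans h1, h2⟩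
      · obtain ⟨c, hc, hc'⟩ := exists_deriv_eq_zero hxy
          p.continuous.continuousOn (hpx.trans hy.1.symm)
        rw [Polynomial.deriv] at hc'
        exact ⟨c, ⟨hc', hc.2.trans hy.2⟩, hc.1, hc.2⟩)
  rw [Finset.card_insert_of_notMem h0] at key
  omega

/-! ### Products of factors 1 + bD acting on monomials -/

/-- The differential operator `A(d/dx)` with constant coefficients. -/
def diffOp (A : ℝ[X]) : ℝ[X] →ₗ[ℝ] ℝ[X] :=
  aeval (derivative : Module.End ℝ ℝ[X]) A

/-- The polynomial `∏ (1 + b x)`, `b` running over a multiset. -/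
def factorPoly (B : Multiset ℝ) : ℝ[X] := (B.map fun b => 1 + C b * X).prod

/-- The monomial `(-x)^n / n!`. -/
def expTerm (n : ℕ) : ℝ[X] := C ((-1) ^ n / (n.factorial : ℝ)) * X ^ n

theorem diffOp_mul (A B p : ℝ[X]) : diffOp (A * B) p = diffOp A (diffOp B p) := by
  simp [diffOp]

theorem diffOp_one (p : ℝ[X]) : diffOp 1 p = p := by simp [diffOp]

theorem diffOp_one_add_C_mul_X (b : ℝ) (p : ℝ[X]) :
    diffOp (1 + C b * X) p = p + C b * derivative p := by
  simp [diffOp, smul_eq_C_mul]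

theorem derivative_diffOp (A p : ℝ[X]) : derivative (diffOp A p) = diffOp A (derivative p) := by
  have h1 : derivative (diffOp A p) = diffOp (X * A) p := by simp [diffOp]
  have h2 : diffOp A (derivative p) = diffOp (A * X) p := by simp [diffOp]
  rw [h1, h2, mul_comm]

theorem factorPoly_cons (b : ℝ) (B : Multiset ℝ) :
    factorPoly (b ::ₘ B) = (1 + C b * X) * factorPoly B := by simp [factorPoly]

theorem factorPoly_add (A B : Multiset ℝ) :
    factorPoly (A + B) = factorPoly A * factorPoly B := by simp [factorPoly]

theorem factorPoly_filter_ne_zero (B : Multiset ℝ) :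
    factorPoly (B.filter (· ≠ 0)) = factorPoly B := by
  induction B using Multiset.induction_on with
  | empty => simp
  | cons b B ih =>
    by_cases hb : b = 0
    · rw [Multiset.filter_cons_of_neg _ (by simpa using hb), ih, factorPoly_cons, hb]; simp
    · rw [Multiset.filter_cons_of_pos (p := fun b : ℝ => b ≠ 0) _ hb, factorPoly_cons, factorPoly_cons, ih]

theorem diffOp_factorPoly_cons (b : ℝ) (B : Multiset ℝ) (p : ℝ[X]) :
    diffOp (factorPoly (b ::ₘ B)) p =
      diffOp (factorPoly B) p + C b * derivative (diffOp (factorPoly B) p) := by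
  rw [factorPoly_cons, diffOp_mul, diffOp_one_add_C_mul_X]

theorem derivative_expTerm_succ (n : ℕ) : derivative (expTerm (n + 1)) = -expTerm n := by
  have h : ((n : ℝ) + 1) ≠ 0 := by positivity
  have h' : (n.factorial : ℝ) ≠ 0 := by positivity
  rw [expTerm, expTerm, derivative_C_mul_X_pow, ← neg_mul, ← C_neg, Nat.add_sub_cancel]
  congr 2
  rw [Nat.factorial_succ]
  push_cast
  field_simp
  ring

theorem derivative_expTerm_zero : derivative (expTerm 0) = 0 := by simp [expTerm]

theorem expTerm_coeff_ne_zero (n : ℕ) : ((-1) ^ n / (n.factorial : ℝ)) ≠ 0 := by positivity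

theorem natDegree_expTerm (n : ℕ) : (expTerm n).natDegree = n :=
  natDegree_C_mul_X_pow _ _ (expTerm_coeff_ne_zero n)

theorem expTerm_ne_zero (n : ℕ) : expTerm n ≠ 0 := by
  rw [expTerm, ne_eq, C_mul_X_pow_eq_monomial, monomial_eq_zero_iff]
  exact expTerm_coeff_ne_zero n

theorem roots_expTerm (n : ℕ) : (expTerm n).roots = Multiset.replicate n 0 := by
  rw [expTerm, roots_C_mul _ (expTerm_coeff_ne_zero n), roots_X_pow, Multiset.nsmul_singleton]

theorem simpleOff_expTerm (n : ℕ) : SimpleOff n (expTerm n) where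
  splits := Splits.C_mul_X_pow _ _
  ne_zero := expTerm_ne_zero n
  simple x hx := by
    rw [← count_roots, roots_expTerm, Multiset.count_replicate, if_neg (Ne.symm hx)]
    exact zero_le_one
  mult := by left; rw [← count_roots, roots_expTerm, Multiset.count_replicate_self]

/-- The truncated subtraction is intended: once the multiplicity at 0 is used up, further factors
keep every zero simple, possibly including one at 0. -/
theorem SimpleOff.diffOp_factorPoly {μ : ℕ} {p : ℝ[X]} (h : SimpleOff μ p) {B : Multiset ℝ}
    (hB : ∀ b ∈ B, b ≠ 0) : SimpleOff (μ - B.card) (diffOp (factorPoly B) p) := by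
  induction B using Multiset.induction_on with
  | empty => simpa [factorPoly, diffOp_one] using h
  | cons b B ih =>
    rw [diffOp_factorPoly_cons, Multiset.card_cons, ← Nat.sub_sub]
    exact (ih fun t ht => hB t (Multiset.mem_cons_of_mem ht)).add_C_mul_derivative
      (hB b (Multiset.mem_cons_self _ _))

theorem rootMultiplicity_zero_diffOp {B : Multiset ℝ} (hB : ∀ b ∈ B, b ≠ 0) {n : ℕ}
    (hn : B.card ≤ n) :
    (diffOp (factorPoly B) (expTerm n)).rootMultiplicity 0 = n - B.card := by
  induction B using Multiset.induction_on with
  | empty =>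
    simp only [factorPoly, Multiset.map_zero, Multiset.prod_zero, diffOp_one, Multiset.card_zero,
      Nat.sub_zero]
    rw [← count_roots, roots_expTerm, Multiset.count_replicate_self]
  | cons b B ih =>
    have hB' := fun t ht => hB t (Multiset.mem_cons_of_mem ht)
    rw [Multiset.card_cons] at hn ⊢
    have h1 := ih hB' (by omega)
    rw [diffOp_factorPoly_cons, rootMultiplicity_zero_add_C_mul_derivative
      ((simpleOff_expTerm n).diffOp_factorPoly hB').ne_zero (hB b (Multiset.mem_cons_self _ _))
      (by omega), h1]
    omega

theorem natDegree_diffOp_factorPoly (B : Multiset ℝ) (p : ℝ[X]) :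
    (diffOp (factorPoly B) p).natDegree = p.natDegree := by
  induction B using Multiset.induction_on with
  | empty => simp [factorPoly, diffOp_one]
  | cons b B ih => rw [diffOp_factorPoly_cons, natDegree_add_C_mul_derivative, ih]

/-- When all b have one sign, the multiplicity at 0 is exact even for more than n factors: after 0
ceases to be a zero, all zeros lie strictly on one side and stay there. -/
theorem roots_nonneg_diffOp_factorPoly {ε : ℝ} (hε : ε ^ 2 = 1) {B : Multiset ℝ}
    (hB0 : ∀ b ∈ B, b ≠ 0) (hB : ∀ b ∈ B, ε * b ≤ 0) (n : ℕ) :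
    (∀ r ∈ (diffOp (factorPoly B) (expTerm n)).roots, 0 ≤ ε * r) ∧
      (diffOp (factorPoly B) (expTerm n)).rootMultiplicity 0 = n - B.card := by
  induction B using Multiset.induction_on with
  | empty =>
    simp only [factorPoly, Multiset.map_zero, Multiset.prod_zero, diffOp_one, Multiset.card_zero,
      Nat.sub_zero]
    refine ⟨fun r hr => ?_, ?_⟩
    · rw [roots_expTerm] at hr
      rw [Multiset.eq_of_mem_replicate hr, mul_zero]
    · rw [← count_roots, roots_expTerm, Multiset.count_replicate_self]
  | cons b B ih =>
    have hB0' := fun t ht => hB0 t (Multiset.mem_cons_of_mem ht)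
    have hb0 := hB0 b (Multiset.mem_cons_self _ _)
    have hb := hB b (Multiset.mem_cons_self _ _)
    obtain ⟨h1, h2⟩ := ih hB0' fun t ht => hB t (Multiset.mem_cons_of_mem ht)
    have hS := (simpleOff_expTerm n).diffOp_factorPoly hB0'
    rw [diffOp_factorPoly_cons]
    refine ⟨roots_nonneg_add_C_mul_derivative hS.splits hS.ne_zero hε hb h1, ?_⟩
    rw [Multiset.card_cons, ← Nat.sub_sub, ← h2]
    by_cases hm : (diffOp (factorPoly B) (expTerm n)).rootMultiplicity 0 = 0
    · rw [hm]
      apply rootMultiplicity_eq_zero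
      intro h0
      have hpos : ∀ r ∈ (diffOp (factorPoly B) (expTerm n)).roots, 0 < ε * r := by
        intro r hr
        refine lt_of_le_of_ne (h1 r hr) fun h => ?_
        have hr0 : r = 0 := by
          refine (mul_eq_zero.1 h.symm).resolve_left ?_
          rintro rfl; norm_num at hε
        subst hr0
        rw [← Multiset.count_pos, count_roots, hm] at hr
        exact lt_irrefl _ hr
      have := roots_pos_add_C_mul_derivative hS.splits hS.ne_zero hε hb hpos 0
        ((mem_roots (add_C_mul_derivative_ne_zero hS.ne_zero b)).2 h0)
      simp at this
    · exact rootMultiplicity_zero_add_C_mul_derivative hS.ne_zero hb0 hm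

/-- The factors commute, so those with εb ≤ 0 may act first; they put no zero on the side εx < 0.
Each remaining factor then adds at most one there. -/
theorem card_filter_diffOp_factorPoly_le {ε : ℝ} (hε : ε ^ 2 = 1) {B : Multiset ℝ}
    (hB0 : ∀ b ∈ B, b ≠ 0) (n : ℕ) :
    ((realZeros (diffOp (factorPoly B) (expTerm n))).filter (ε * · < 0)).card ≤
      (B.filter (0 < ε * ·)).card := by
  have hε0 : ε ≠ 0 := by rintro rfl; norm_num at hε
  have key : ∀ (C : Multiset ℝ), (∀ b ∈ C, b ≠ 0) → ∀ (μ : ℕ) (p : ℝ[X]), SimpleOff μ p →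
      (∀ r ∈ p.roots, 0 ≤ ε * r) →
      ((realZeros (diffOp (factorPoly C) p)).filter (ε * · < 0)).card ≤ C.card := by
    intro C hC μ p hp hr
    induction C using Multiset.induction_on with
    | empty =>
      rw [Multiset.card_zero, Nat.le_zero, Finset.card_eq_zero, Finset.filter_eq_empty_iff]
      intro x hx
      rw [not_lt]
      apply hr
      simpa [realZeros, factorPoly, diffOp_one] using hx
    | cons b C ih =>
      have hC' := fun t ht => hC t (Multiset.mem_cons_of_mem ht)
      rw [diffOp_factorPoly_cons, Multiset.card_cons]
      refine (card_filter_add_C_mul_derivative_le (hp.diffOp_factorPoly hC')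
        (hC b (Multiset.mem_cons_self _ _)) _ ?_ ?_).trans (Nat.add_le_add_right (ih hC') 1)
      · rintro x hx rfl; simp at hx
      · intro x y z hx hy hxz hzy
        rcases lt_or_gt_of_ne hε0 with h | h <;> nlinarith
  conv_lhs => rw [← Multiset.filter_add_not (p := fun b => 0 < ε * b) B]
  rw [factorPoly_add, diffOp_mul]
  have hB1 : ∀ b ∈ B.filter (fun b => ¬ 0 < ε * b), b ≠ 0 := fun b hb => hB0 b (Multiset.mem_filter.1 hb).1
  exact key _ (fun b hb => hB0 b (Multiset.mem_filter.1 hb).1) _ _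
    ((simpleOff_expTerm n).diffOp_factorPoly hB1)
    (roots_nonneg_diffOp_factorPoly hε hB1
      (fun b hb => not_lt.1 (Multiset.mem_filter.1 hb).2) n).1

theorem card_neg_le {B : Multiset ℝ} (hB0 : ∀ b ∈ B, b ≠ 0) (n : ℕ) :
    ((realZeros (diffOp (factorPoly B) (expTerm n))).filter (· < 0)).card ≤
      (B.filter (0 < ·)).card := by
  simpa using card_filter_diffOp_factorPoly_le (ε := 1) (by norm_num) hB0 n

theorem card_pos_le {B : Multiset ℝ} (hB0 : ∀ b ∈ B, b ≠ 0) (n : ℕ) :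
    ((realZeros (diffOp (factorPoly B) (expTerm n))).filter (0 < ·)).card ≤
      (B.filter (· < 0)).card := by
  simpa using card_filter_diffOp_factorPoly_le (ε := -1) (by norm_num) hB0 n

/-- There are exactly `B.card` nonzero zeros, which is the sum of the bounds for the negative and
the positive ones; both bounds are therefore attained. -/
theorem card_neg_of_card_le {B : Multiset ℝ} (hB0 : ∀ b ∈ B, b ≠ 0) {n : ℕ} (hn : B.card ≤ n) :
    ((realZeros (diffOp (factorPoly B) (expTerm n))).filter (· < 0)).card =
      (B.filter (0 < ·)).card := by
  have hS := (simpleOff_expTerm n).diffOp_factorPoly hB0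
  have h1 := card_neg_le hB0 n
  have h2 := card_pos_le hB0 n
  have h3 := hS.card_realZeros_erase
  rw [natDegree_diffOp_factorPoly, natDegree_expTerm] at h3
  have h5 := rootMultiplicity_zero_diffOp hB0 hn
  set S := realZeros (diffOp (factorPoly B) (expTerm n))
  have h6 : (S.erase 0).card = (S.filter (· < 0)).card + (S.filter (0 < ·)).card := by
    rw [← Finset.card_union_of_disjoint]
    · congr 1
      ext x
      rw [Finset.mem_erase, Finset.mem_union, Finset.mem_filter, Finset.mem_filter, ← and_or_left,
        lt_or_lt_iff_ne, and_comm]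
    · rw [Finset.disjoint_filter]
      intro x _ h
      exact h.le.not_gt
  have h7 : B.card = (B.filter (0 < ·)).card + (B.filter (· < 0)).card := by
    conv_lhs => rw [← Multiset.filter_add_not (p := fun b => 0 < b) B, Multiset.card_add]
    congr 2
    apply Multiset.filter_congr
    intro x hx
    rw [not_lt]
    exact ⟨fun h => lt_of_le_of_ne h (hB0 x hx), le_of_lt⟩
  omega

/-! ### Negative zeros when there are more factors than the degree -/

/-- The leading coefficients of `V (1 - x)^N` eventually alternate in sign. -/
theorem exists_pos_le_coeff_mul_one_sub_X_pow {V : ℝ[X]} (hV : V ≠ 0) (j : ℕ) :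
    ∃ c : ℝ, 0 < c ∧ ∀ᶠ N : ℕ in atTop, c ≤ (-1) ^ (N + j) * V.leadingCoeff *
      (V * (1 - X) ^ N).coeff (V.natDegree + N - j) := by
  have hstep : ∀ N i, (V * (1 - X) ^ (N + 1)).coeff (i + 1) =
      (V * (1 - X) ^ N).coeff (i + 1) - (V * (1 - X) ^ N).coeff i := by
    intro N i
    rw [pow_succ, ← mul_assoc, mul_sub, mul_one, coeff_sub, coeff_mul_X]
  have hdeg : ∀ N, (V * (1 - X) ^ N).natDegree ≤ V.natDegree + N := by
    intro N
    refine natDegree_mul_le.trans (Nat.add_le_add_left (natDegree_pow_le.trans ?_) _)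
    have : (1 - X : ℝ[X]).natDegree ≤ 1 := by compute_degree
    simpa using Nat.mul_le_mul_left N this
  have hlc : V.leadingCoeff ≠ 0 := leadingCoeff_ne_zero.2 hV
  induction j with
  | zero =>
    refine ⟨V.leadingCoeff ^ 2, by positivity, Eventually.of_forall fun N => le_of_eq ?_⟩
    rw [Nat.add_zero, Nat.sub_zero]
    induction N with
    | zero => simp [sq]
    | succ N ih =>
      rw [← add_assoc, hstep, coeff_eq_zero_of_natDegree_lt (Nat.lt_succ_of_le (hdeg N)), ih]
      ring
  | succ j ih =>
    obtain ⟨c, hc, hev⟩ := ih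
    obtain ⟨N₀, hN₀⟩ := eventually_atTop.1 hev
    set s : ℕ → ℝ := fun N => (-1) ^ (N + (j + 1)) * V.leadingCoeff *
      (V * (1 - X) ^ N).coeff (V.natDegree + N - (j + 1)) with hs
    -- Multiplying by 1 - x adds the signed coefficient of index j, which is at least c, to that of
    -- index j + 1. Hence `s` grows at least linearly and eventually exceeds 1.
    have hinc : ∀ N, N₀ + j + 1 ≤ N → s N + c ≤ s (N + 1) := by
      intro N hN
      have h1 := hN₀ N (by omega)
      have h2 : s (N + 1) = s N + (-1) ^ (N + j) * V.leadingCoeff *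
          (V * (1 - X) ^ N).coeff (V.natDegree + N - j) := by
        obtain ⟨i, hi⟩ : ∃ i, V.natDegree + N = i + 1 + j := ⟨V.natDegree + N - 1 - j, by omega⟩
        simp only [hs]
        rw [show V.natDegree + (N + 1) - (j + 1) = i + 1 by omega,
          show V.natDegree + N - (j + 1) = i by omega,
          show V.natDegree + N - j = i + 1 by omega, hstep]
        ring
      linarith
    have hlin : ∀ k : ℕ, s (N₀ + j + 1) + k * c ≤ s (N₀ + j + 1 + k) := by
      intro k
      induction k with
      | zero => simp
      | succ k ih =>
        have := hinc (N₀ + j + 1 + k) (by omega)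
        rw [← add_assoc]
        push_cast
        linarith
    refine ⟨1, one_pos, ?_⟩
    obtain ⟨k, hk⟩ := exists_nat_ge ((1 - s (N₀ + j + 1)) / c)
    rw [div_le_iff₀ hc] at hk
    rw [eventually_atTop]
    refine ⟨N₀ + j + 1 + k, fun N hN => ?_⟩
    obtain ⟨l, rfl⟩ := Nat.exists_eq_add_of_le hN
    have h1 := hlin (k + l)
    have h2 : (0 : ℝ) ≤ l * c := by positivity
    push_cast at h1
    rw [← add_assoc] at h1
    change 1 ≤ s (N₀ + j + 1 + k + l)
    linarith

theorem eventually_coeff_mul_coeff_neg {V : ℝ[X]} (hV : V ≠ 0) (t : ℕ) :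
    ∀ᶠ N : ℕ in atTop, ∀ j < t,
      (V * (1 - X) ^ N).coeff (V.natDegree + N - j) *
        (V * (1 - X) ^ N).coeff (V.natDegree + N - (j + 1)) < 0 := by
  have key : ∀ j ∈ Finset.range t, ∀ᶠ N : ℕ in atTop,
      (V * (1 - X) ^ N).coeff (V.natDegree + N - j) *
        (V * (1 - X) ^ N).coeff (V.natDegree + N - (j + 1)) < 0 := by
    intro j _
    obtain ⟨c, hc, h1⟩ := exists_pos_le_coeff_mul_one_sub_X_pow hV j
    obtain ⟨c', hc', h2⟩ := exists_pos_le_coeff_mul_one_sub_X_pow hV (j + 1)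
    filter_upwards [h1, h2] with N h1 h2
    have h3 := mul_pos (hc.trans_le h1) (hc'.trans_le h2)
    have h4 : ((-1 : ℝ) ^ (N + j)) ^ 2 = 1 := by rw [← pow_mul, mul_comm, pow_mul]; simp
    rw [← add_assoc, pow_succ] at h3
    by_contra! h5
    have h6 := mul_nonneg (sq_nonneg ((-1) ^ (N + j) * V.leadingCoeff)) h5
    linarith
  filter_upwards [(eventually_all_finset _).2 key] with N hN j hj
  exact hN j (Finset.mem_range.2 hj)

theorem iterate_derivative_expTerm (i n : ℕ) :
    derivative^[i] (expTerm n) = if i ≤ n then (-1) ^ i * expTerm (n - i) else 0 := by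
  induction i with
  | zero => simp
  | succ i ih =>
    rw [Function.iterate_succ_apply', ih]
    by_cases h : i + 1 ≤ n
    · obtain ⟨m, rfl⟩ := Nat.exists_eq_add_of_le h
      rw [if_pos (by omega), if_pos h, show i + 1 + m - i = m + 1 by omega,
        show i + 1 + m - (i + 1) = m by omega]
      have : ((-1 : ℝ[X]) ^ i) = C ((-1) ^ i) := by simp
      rw [this, derivative_C_mul, derivative_expTerm_succ]
      simp [pow_succ]
    · rw [if_neg h]
      by_cases h' : i ≤ n
      · have : n - i = 0 := by omega
        have h2 : ((-1 : ℝ[X]) ^ i) = C ((-1) ^ i) := by simp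
        rw [if_pos h', this, h2, derivative_C_mul, derivative_expTerm_zero, mul_zero]
      · rw [if_neg h', derivative_zero]

theorem diffOp_C_mul (a : ℝ) (A p : ℝ[X]) : diffOp (C a * A) p = C a * diffOp A p := by
  simp [diffOp, smul_eq_C_mul]

theorem diffOp_X_pow (i : ℕ) (p : ℝ[X]) : diffOp (X ^ i) p = derivative^[i] p := by
  simp [diffOp, Module.End.pow_apply]

theorem diffOp_eq_sum (A p : ℝ[X]) :
    diffOp A p = ∑ i ∈ Finset.range (A.natDegree + 1), C (A.coeff i) * derivative^[i] p := by
  rw [diffOp, aeval_eq_sum_range, LinearMap.sum_apply]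
  refine Finset.sum_congr rfl fun i _ => ?_
  rw [LinearMap.smul_apply, Module.End.pow_apply, smul_eq_C_mul]

theorem eval_zero_expTerm (n : ℕ) : (expTerm n).eval 0 = if n = 0 then 1 else 0 := by
  by_cases h : n = 0 <;> simp [expTerm, h]

/-- Only the n-th derivative of the monomial survives at 0. -/
theorem eval_zero_diffOp_expTerm (A : ℝ[X]) (n : ℕ) :
    (diffOp A (expTerm n)).eval 0 = (-1) ^ n * A.coeff n := by
  rw [diffOp_eq_sum, eval_finsetSum]
  have h : ∀ i ∈ Finset.range (A.natDegree + 1),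
      (C (A.coeff i) * derivative^[i] (expTerm n)).eval 0 =
        if i = n then (-1) ^ n * A.coeff n else 0 := by
    intro i _
    rw [iterate_derivative_expTerm]
    by_cases h1 : i ≤ n
    · rw [if_pos h1]
      simp only [eval_mul, eval_C, eval_pow, eval_neg, eval_one, eval_zero_expTerm]
      by_cases h2 : i = n
      · subst h2; simp [mul_comm]
      · rw [if_neg (by omega), if_neg h2]; simp
    · rw [if_neg h1, if_neg (by omega)]; simp
  rw [Finset.sum_congr rfl h, Finset.sum_ite_eq']
  split_ifs with h1
  · rfl
  · rw [coeff_eq_zero_of_natDegree_lt (by simpa using h1), mul_zero]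

/-- For `n < card B`, the number of negative zeros is still the number of positive elements of
`B`, provided that the top coefficients of `factorPoly B` alternate in sign. -/
theorem card_neg_of_coeff_alternate {B : Multiset ℝ} (hB0 : ∀ b ∈ B, b ≠ 0) {n t : ℕ}
    (hn : B.card = n + t)
    (hc : ∀ j < t, (factorPoly B).coeff (n + t - j) * (factorPoly B).coeff (n + t - (j + 1)) < 0) :
    ((realZeros (diffOp (factorPoly B) (expTerm n))).filter (· < 0)).card =
      (B.filter (0 < ·)).card := by
  refine le_antisymm (card_neg_le hB0 n) ?_
  -- Descent from degree n + t = `B.card`, where the count is exact. Differentiation lowers the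
  -- degree by one, and the coefficient condition gives p(0)p'(0) < 0 at each stage.
  have key : ∀ j ≤ t, (B.filter (0 < ·)).card ≤
      ((realZeros (diffOp (factorPoly B) (expTerm (n + t - j)))).filter (· < 0)).card := by
    intro j hj
    induction j with
    | zero => exact (card_neg_of_card_le hB0 hn.le).ge
    | succ j ih =>
      refine (ih (by omega)).trans ?_
      obtain ⟨k, hk⟩ : ∃ k, n + t - j = k + 1 := ⟨n + t - (j + 1), by omega⟩
      have h1 : derivative (diffOp (factorPoly B) (expTerm (k + 1))) =
          -diffOp (factorPoly B) (expTerm k) := by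
        rw [derivative_diffOp, derivative_expTerm_succ, map_neg]
      have h2 := hc j (by omega)
      rw [show n + t - (j + 1) = k by omega, hk] at h2 ⊢
      have h3 := card_neg_realZeros_le_derivative
        (p := diffOp (factorPoly B) (expTerm (k + 1))) (by
          rw [h1, eval_neg, eval_zero_diffOp_expTerm, eval_zero_diffOp_expTerm]
          have : ((-1 : ℝ) ^ k) ^ 2 = 1 := by rw [← pow_mul, mul_comm, pow_mul]; simp
          rw [pow_succ]
          linear_combination h2 + (factorPoly B).coeff (k + 1) * (factorPoly B).coeff k * this)
      rw [h1] at h3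
      simpa [realZeros, roots_neg] using h3
  simpa using key t le_rfl

/-! ### Laguerre combinations as images of monomials -/

theorem laguerre_eq_diffOp {α : ℤ} {n M : ℕ} (hM : (M : ℤ) = n + α) :
    laguerre (α : ℝ) n = diffOp ((1 - X) ^ M) (expTerm n) := by
  have hM' : (n : ℝ) + (α : ℝ) = (M : ℝ) := by exact_mod_cast hM.symm
  have h1 : ((1 - X) ^ M : ℝ[X]) =
      ∑ i ∈ Finset.range (M + 1), C ((M.choose i : ℝ) * (-1) ^ i) * X ^ i := by
    rw [sub_eq_neg_add, add_pow]
    refine Finset.sum_congr rfl fun i _ => ?_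
    rw [neg_pow (X : ℝ[X])]
    simp
    ring
  have h2 : ∀ i, diffOp (C ((M.choose i : ℝ) * (-1) ^ i) * X ^ i) (expTerm n) =
      if i ≤ n then C (M.choose i : ℝ) * expTerm (n - i) else 0 := by
    intro i
    have : diffOp (C ((M.choose i : ℝ) * (-1) ^ i) * X ^ i) (expTerm n) =
        C ((M.choose i : ℝ) * (-1) ^ i) * derivative^[i] (expTerm n) := by
      rw [diffOp_C_mul, diffOp_X_pow]
    rw [this, iterate_derivative_expTerm]
    split_ifs with h
    · rw [show ((-1 : ℝ[X]) ^ i) = C ((-1) ^ i) by simp, ← mul_assoc, ← C_mul, mul_assoc,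
        ← mul_pow]
      simp
    · simp
  have h3 : diffOp ((1 - X) ^ M) (expTerm n) =
      ∑ i ∈ Finset.range (M + n + 1), if i ≤ n then C (M.choose i : ℝ) * expTerm (n - i) else 0 := by
    have : diffOp ((1 - X) ^ M) (expTerm n) =
        ∑ i ∈ Finset.range (M + 1), diffOp (C ((M.choose i : ℝ) * (-1) ^ i) * X ^ i) (expTerm n) := by
      rw [h1]
      simp only [diffOp, map_sum, LinearMap.sum_apply]
    rw [this, Finset.sum_congr rfl fun i _ => h2 i]
    apply Finset.sum_subset
    · intro i; simp; omega
    · intro i _ hi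
      rw [Nat.choose_eq_zero_of_lt (by simpa using hi)]
      simp
  have h4 : ∑ i ∈ Finset.range (M + n + 1),
      (if i ≤ n then C (M.choose i : ℝ) * expTerm (n - i) else 0) =
      ∑ i ∈ Finset.range (n + 1), C (M.choose i : ℝ) * expTerm (n - i) := by
    rw [← Finset.sum_filter]
    congr 1
    ext i; simp; omega
  rw [h3, h4, laguerre, ← Finset.sum_range_reflect]
  refine Finset.sum_congr rfl fun i hi => ?_
  have hi' : i ≤ n := by simpa [Nat.lt_succ_iff] using hi
  rw [show n + 1 - 1 - i = n - i by omega, show n - (n - i) = i by omega, hM',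
    Ring.choose_natCast, expTerm, ← mul_assoc, ← C_mul, mul_div_assoc]

theorem expTerm_sub_eq_diffOp {j n : ℕ} (h : j ≤ n) :
    expTerm (n - j) = diffOp ((-X) ^ j) (expTerm n) := by
  have : diffOp ((-X) ^ j) (expTerm n) = (-1) ^ j * derivative^[j] (expTerm n) := by
    rw [neg_pow, show ((-1 : ℝ[X]) ^ j) = C ((-1) ^ j) by simp, diffOp_C_mul, diffOp_X_pow]
  rw [this, iterate_derivative_expTerm, if_pos h, ← mul_assoc, ← mul_pow]
  simp

theorem natDegree_assocPoly_le (K : ℕ) (γ : ℕ → ℝ) : (assocPoly K γ).natDegree ≤ K := by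
  refine natDegree_sum_le_of_forall_le _ _ fun j _ => ?_
  exact (natDegree_C_mul_X_pow_le _ _).trans (Nat.sub_le _ _)

theorem coeff_assocPoly (K : ℕ) (γ : ℕ → ℝ) : (assocPoly K γ).coeff K = γ 0 := by
  rw [assocPoly, finsetSum_coeff, Finset.sum_eq_single 0]
  · simp
  · intro j hj hj0
    have : j < K + 1 := Finset.mem_range.1 hj
    rw [coeff_C_mul_X_pow, if_neg (by omega)]
  · simp

theorem natDegree_assocPoly {K : ℕ} {γ : ℕ → ℝ} (h : γ 0 = 1) : (assocPoly K γ).natDegree = K :=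
  le_antisymm (natDegree_assocPoly_le K γ)
    (le_natDegree_of_ne_zero (by rw [coeff_assocPoly, h]; exact one_ne_zero))

theorem monic_assocPoly {K : ℕ} {γ : ℕ → ℝ} (h : γ 0 = 1) : (assocPoly K γ).Monic := by
  rw [Monic, leadingCoeff, natDegree_assocPoly h, coeff_assocPoly, h]

/-- Both sides equal (-y)^K P((1-y)/(-y)) at every y > 0: each factor y' - r of P becomes 1 + (r-1)y
after multiplication by -y, where y' = (1-y)/(-y). -/
theorem factorPoly_roots_assocPoly {K : ℕ} {γ : ℕ → ℝ} (h : γ 0 = 1)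
    (hP : (assocPoly K γ).Splits) :
    factorPoly ((assocPoly K γ).roots.map (· - 1)) =
      ∑ j ∈ Finset.range (K + 1), C (γ j) * ((1 - X) ^ (K - j) * (-X) ^ j) := by
  apply eq_of_infinite_eval_eq
  refine Set.Infinite.mono ?_ (Set.Ioi_infinite (0 : ℝ))
  intro y hy
  have hy0 : -y ≠ 0 := neg_ne_zero.2 (ne_of_gt hy)
  have hcard : (assocPoly K γ).roots.card = K := by
    rw [← hP.natDegree_eq_card_roots, natDegree_assocPoly h]
  have h1 : (factorPoly ((assocPoly K γ).roots.map (· - 1))).eval y =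
      (-y) ^ K * (assocPoly K γ).eval ((1 - y) / (-y)) := by
    have h2 : (-y) ^ K = ((assocPoly K γ).roots.map fun _ => -y).prod := by
      rw [Multiset.map_const', Multiset.prod_replicate, hcard]
    rw [hP.eval_eq_prod_roots_of_monic (monic_assocPoly h), factorPoly, eval_multiset_prod, h2,
      ← Multiset.prod_map_mul, Multiset.map_map, Multiset.map_map]
    congr 1
    refine Multiset.map_congr rfl fun r _ => ?_
    rw [mul_sub, mul_div_cancel₀ _ hy0]
    simp
    ring
  rw [Set.mem_ofPred_eq, h1, assocPoly, eval_finsetSum, eval_finsetSum, Finset.mul_sum]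
  refine Finset.sum_congr rfl fun j hj => ?_
  have hj' : j ≤ K := by simpa [Nat.lt_succ_iff] using hj
  obtain ⟨i, rfl⟩ := Nat.exists_eq_add_of_le hj'
  simp only [eval_mul, eval_C, eval_pow, eval_X, eval_sub, eval_one, eval_neg,
    Nat.add_sub_cancel_left, div_pow]
  rw [pow_add]
  field_simp

theorem factorPoly_replicate (N : ℕ) : factorPoly (Multiset.replicate N (-1)) = (1 - X) ^ N := by
  rw [factorPoly, Multiset.map_replicate, Multiset.prod_replicate]
  congr 1
  simp [sub_eq_add_neg]

/-- The combination of Laguerre polynomials as the image of a monomial under a differential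
operator with constant coefficients. -/
theorem laguerreComb_eq_diffOp {K : ℕ} {γ : ℕ → ℝ} (h : γ 0 = 1) (hP : (assocPoly K γ).Splits)
    {α : ℤ} {n N : ℕ} (hn : K ≤ n) (hN : (n : ℤ) + α = K + N) :
    laguerreComb (α : ℝ) K γ n =
      diffOp (factorPoly (((assocPoly K γ).roots.filter (· ≠ 1)).map (· - 1) +
        Multiset.replicate N (-1))) (expTerm n) := by
  have h0 : factorPoly (((assocPoly K γ).roots.filter (· ≠ 1)).map (· - 1)) =
      factorPoly ((assocPoly K γ).roots.map (· - 1)) := by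
    rw [← factorPoly_filter_ne_zero ((assocPoly K γ).roots.map (· - 1)), Multiset.filter_map]
    congr 2
    refine Multiset.filter_congr fun x _ => ?_
    simp [sub_eq_zero]
  rw [factorPoly_add, h0, factorPoly_replicate, factorPoly_roots_assocPoly h hP, Finset.sum_mul,
    laguerreComb]
  have h1 : ∀ (s : Finset ℕ) (f : ℕ → ℝ[X]) (p : ℝ[X]),
      diffOp (∑ j ∈ s, f j) p = ∑ j ∈ s, diffOp (f j) p := by
    intro s f p
    simp only [diffOp, map_sum, LinearMap.sum_apply]
  rw [h1]
  refine Finset.sum_congr rfl fun j hj => ?_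
  have hj' : j ≤ K := by simpa [Nat.lt_succ_iff] using hj
  have h2 : C (γ j) * ((1 - X) ^ (K - j) * (-X) ^ j) * (1 - X) ^ N =
      C (γ j) * ((1 - X) ^ (K - j + N) * (-X) ^ j) := by rw [pow_add]; ring
  rw [h2, diffOp_mul, diffOp_mul, ← expTerm_sub_eq_diffOp (hj'.trans hn),
    ← laguerre_eq_diffOp (α := α) (by omega)]
  simp [diffOp, smul_eq_C_mul]

/-! ### The factors of q_n, and the conclusions -/

theorem natDegree_factorPoly {B : Multiset ℝ} (hB : ∀ b ∈ B, b ≠ 0) :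
    factorPoly B ≠ 0 ∧ (factorPoly B).natDegree = B.card := by
  induction B using Multiset.induction_on with
  | empty => simp [factorPoly]
  | cons b B ih =>
    obtain ⟨h1, h2⟩ := ih fun t ht => hB t (Multiset.mem_cons_of_mem ht)
    have hb : (1 + C b * X : ℝ[X]).natDegree = 1 := by
      rw [add_comm, ← C_1]
      exact natDegree_linear (hB b (Multiset.mem_cons_self _ _))
    have hb0 : (1 + C b * X : ℝ[X]) ≠ 0 := by intro h; rw [h] at hb; simp at hb
    rw [factorPoly_cons, Multiset.card_cons, natDegree_mul hb0 h1, hb, h2]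
    exact ⟨mul_ne_zero hb0 h1, add_comm _ _⟩

/-- The coefficients of the factors of the differential operator that produces a combination of
Laguerre polynomials from a monomial, for `P = p` and `N` additional factors `1 - d/dx`. -/
def shiftedRoots (p : ℝ[X]) (N : ℕ) : Multiset ℝ :=
  (p.roots.filter (· ≠ 1)).map (· - 1) + Multiset.replicate N (-1)

theorem shiftedRoots_ne_zero {p : ℝ[X]} {N : ℕ} : ∀ b ∈ shiftedRoots p N, b ≠ 0 := by
  intro b hb
  rw [shiftedRoots, Multiset.mem_add] at hb
  rcases hb with hb | hb
  · obtain ⟨r, hr, rfl⟩ := Multiset.mem_map.1 hb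
    exact sub_ne_zero.2 (Multiset.mem_filter.1 hr).2
  · rw [Multiset.eq_of_mem_replicate hb]; norm_num

theorem shiftedRoots_succ (p : ℝ[X]) (N : ℕ) :
    shiftedRoots p (N + 1) = -1 ::ₘ shiftedRoots p N := by
  simp [shiftedRoots, Multiset.replicate_succ]

theorem card_shiftedRoots {p : ℝ[X]} (hp : p.Splits) (N : ℕ) :
    (shiftedRoots p N).card + p.rootMultiplicity 1 = p.natDegree + N := by
  have h : p.roots.card = (p.roots.filter (· ≠ 1)).card + p.rootMultiplicity 1 := by
    rw [← count_roots, Multiset.count_eq_card_filter_eq]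
    conv_lhs => rw [← Multiset.filter_add_not (p := fun x : ℝ => x ≠ 1) p.roots, Multiset.card_add]
    exact congrArg _ (congrArg _ (Multiset.filter_congr fun x _ => by simp [eq_comm]))
  rw [hp.natDegree_eq_card_roots, h, shiftedRoots, Multiset.card_add, Multiset.card_map,
    Multiset.card_replicate]
  ring

theorem card_filter_pos_shiftedRoots (p : ℝ[X]) (N : ℕ) :
    ((shiftedRoots p N).filter (0 < ·)).card = numZerosGtOne p := by
  rw [shiftedRoots, Multiset.filter_add, Multiset.card_add, Multiset.filter_map,
    Multiset.card_map, Multiset.filter_filter, numZerosGtOne]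
  have h1 : (Multiset.replicate N (-1 : ℝ)).filter (0 < ·) = 0 := by
    rw [Multiset.filter_eq_nil]
    intro a ha
    rw [Multiset.eq_of_mem_replicate ha]; norm_num
  rw [h1, Multiset.card_zero, Nat.add_zero]
  refine congrArg _ (Multiset.filter_congr fun x _ => ?_)
  simp only [Function.comp, sub_pos]
  exact ⟨fun h => h.1, fun h => ⟨h, h.ne'⟩⟩

theorem interlaces_diffOp_factorPoly {B : Multiset ℝ} (hB : ∀ b ∈ B, b ≠ 0) (n : ℕ) :
    Interlaces (realZeros (diffOp (factorPoly (-1 ::ₘ B)) (expTerm (n + 1))))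
      (realZeros (diffOp (factorPoly B) (expTerm n))) := by
  have hw := (simpleOff_expTerm (n + 1)).diffOp_factorPoly hB
  have hf := (simpleOff_expTerm n).diffOp_factorPoly hB
  have hg := (simpleOff_expTerm (n + 1)).diffOp_factorPoly (B := -1 ::ₘ B) (by
    intro b hb
    rcases Multiset.mem_cons.1 hb with rfl | hb
    · norm_num
    · exact hB b hb)
  have hd : derivative (diffOp (factorPoly B) (expTerm (n + 1))) =
      -diffOp (factorPoly B) (expTerm n) := by
    rw [derivative_diffOp, derivative_expTerm_succ, map_neg]
  have he : diffOp (factorPoly (-1 ::ₘ B)) (expTerm (n + 1)) =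
      diffOp (factorPoly B) (expTerm (n + 1)) + diffOp (factorPoly B) (expTerm n) := by
    rw [diffOp_factorPoly_cons, hd]; simp
  rw [he] at hg ⊢
  rw [Multiset.card_cons, Nat.add_sub_add_right] at hg
  refine interlaces_sub_derivative ?_ hd hf hg ?_
  -- Truncation matters: (n+1) - `B.card` is one more than n - `B.card` only if `B.card` ≤ n;
  -- otherwise both are 0.
  · by_cases h : B.card ≤ n
    · left; rwa [← Nat.sub_add_comm h]
    · right
      rw [show n + 1 - B.card = 0 by omega] at hw
      exact ⟨by omega, hw⟩
  · rw [natDegree_diffOp_factorPoly, natDegree_diffOp_factorPoly, natDegree_expTerm,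
      natDegree_expTerm]

/-- The excess of factors over the degree is α minus the multiplicity of 1, independent of n. So
only a fixed number of top coefficients must alternate, and one threshold for N suffices. -/
theorem eventually_card_neg_shiftedRoots {p : ℝ[X]} (hp : p.Splits) (α : ℤ) :
    ∃ N₀ : ℕ, ∀ n N : ℕ, N₀ ≤ N → (n : ℤ) + α = p.natDegree + N →
      ((realZeros (diffOp (factorPoly (shiftedRoots p N)) (expTerm n))).filter (· < 0)).card =
        numZerosGtOne p := by
  have hV := natDegree_factorPoly (shiftedRoots_ne_zero (p := p) (N := 0))
  obtain ⟨N₀, hN₀⟩ := eventually_atTop.1 (eventually_coeff_mul_coeff_neg hV.1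
    (α - p.rootMultiplicity 1).toNat)
  refine ⟨N₀, fun n N hN hn => ?_⟩
  have hcard := card_shiftedRoots hp N
  have hcard0 := card_shiftedRoots hp 0
  by_cases hm : (shiftedRoots p N).card ≤ n
  · rw [card_neg_of_card_le shiftedRoots_ne_zero hm, card_filter_pos_shiftedRoots]
  · have ht : (shiftedRoots p N).card = n + (α - p.rootMultiplicity 1).toNat := by omega
    rw [card_neg_of_coeff_alternate shiftedRoots_ne_zero ht, card_filter_pos_shiftedRoots]
    intro j hj
    have h1 := hN₀ N hN j hj
    have h2 : factorPoly (shiftedRoots p N) = factorPoly (shiftedRoots p 0) * (1 - X) ^ N := by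
      simp [shiftedRoots, factorPoly_add, factorPoly_replicate]
    rwa [← h2, hV.2, show (shiftedRoots p 0).card + N =
      n + (α - p.rootMultiplicity 1).toNat by omega] at h1

theorem theorem5p5 (K : ℕ) (hK : 0 < K) (γ : ℕ → ℝ) (hγ0 : γ 0 = 1) (hγK : γ K ≠ 0) (α : ℤ)
    (hP : HasOnlyRealZeros (assocPoly K γ)) :
    -- `α ≥ 0`, all `n ≥ K`; `s` below is the multiplicity of `1` as a zero of `P`
    (0 ≤ α → ∀ n : ℕ, K ≤ n →
      -- `s ≤ α`, in particular `P(1) ≠ 0`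
      ((((assocPoly K γ).rootMultiplicity 1 : ℕ) : ℤ) ≤ α →
        (realZeros (laguerreComb (α : ℝ) K γ n)).card = n ∧
        (∀ x ∈ realZeros (laguerreComb (α : ℝ) K γ n),
          (laguerreComb (α : ℝ) K γ n).rootMultiplicity x = 1) ∧
        (numZerosGtOne (assocPoly K γ) = 0 →
          ∀ x ∈ realZeros (laguerreComb (α : ℝ) K γ n), 0 < x)) ∧
      -- `s > α`
      (α < (((assocPoly K γ).rootMultiplicity 1 : ℕ) : ℤ) →
        (((laguerreComb (α : ℝ) K γ n).rootMultiplicity 0 : ℕ) : ℤ) =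
          -α + (((assocPoly K γ).rootMultiplicity 1 : ℕ) : ℤ) ∧
        ((((realZeros (laguerreComb (α : ℝ) K γ n)).erase 0).card : ℕ) : ℤ) =
          (n : ℤ) + α - (((assocPoly K γ).rootMultiplicity 1 : ℕ) : ℤ) ∧
        (∀ x ∈ (realZeros (laguerreComb (α : ℝ) K γ n)).erase 0,
          (laguerreComb (α : ℝ) K γ n).rootMultiplicity x = 1) ∧
        (numZerosGtOne (assocPoly K γ) = 0 →
          ∀ x ∈ (realZeros (laguerreComb (α : ℝ) K γ n)).erase 0, 0 < x)) ∧
      Interlaces (realZeros (laguerreComb (α : ℝ) K γ (n + 1)))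
        (realZeros (laguerreComb (α : ℝ) K γ n))) ∧
    -- `α ≤ -1`, all large `n`
    (α ≤ -1 → ∀ᶠ n : ℕ in atTop,
      (((laguerreComb (α : ℝ) K γ n).rootMultiplicity 0 : ℕ) : ℤ) =
        -α + (((assocPoly K γ).rootMultiplicity 1 : ℕ) : ℤ) ∧
      ((((realZeros (laguerreComb (α : ℝ) K γ n)).erase 0).card : ℕ) : ℤ) =
        (n : ℤ) + α - (((assocPoly K γ).rootMultiplicity 1 : ℕ) : ℤ) ∧
      (∀ x ∈ (realZeros (laguerreComb (α : ℝ) K γ n)).erase 0,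
        (laguerreComb (α : ℝ) K γ n).rootMultiplicity x = 1) ∧
      Interlaces (realZeros (laguerreComb (α : ℝ) K γ (n + 1)))
        (realZeros (laguerreComb (α : ℝ) K γ n))) ∧
    -- In all cases: the number of negative zeros for large `n`
    (∀ᶠ n : ℕ in atTop,
      ((realZeros (laguerreComb (α : ℝ) K γ n)).filter (fun x => x < 0)).card =
        numZerosGtOne (assocPoly K γ)) := by
  have hS := splits_of_hasOnlyRealZeros hP
  have hdeg := natDegree_assocPoly (K := K) hγ0
  have hq : ∀ n N : ℕ, K ≤ n → (n : ℤ) + α = K + N → laguerreComb (α : ℝ) K γ n =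
      diffOp (factorPoly (shiftedRoots (assocPoly K γ) N)) (expTerm n) :=
    fun n N hn hN => laguerreComb_eq_diffOp hγ0 hS hn hN
  have hneg := eventually_card_neg_shiftedRoots hS α
  have hcard : ∀ N, (shiftedRoots (assocPoly K γ) N).card + (assocPoly K γ).rootMultiplicity 1 =
      K + N := fun N => by rw [card_shiftedRoots hS, hdeg]
  have hpos := card_filter_pos_shiftedRoots (assocPoly K γ)
  rw [hdeg] at hneg
  set s := (assocPoly K γ).rootMultiplicity 1
  have hinter : ∀ n N : ℕ, K ≤ n → (n : ℤ) + α = K + N →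
      Interlaces (realZeros (laguerreComb (α : ℝ) K γ (n + 1)))
        (realZeros (laguerreComb (α : ℝ) K γ n)) := by
    intro n N hn hN
    rw [hq n N hn hN, hq (n + 1) (N + 1) (by omega) (by push_cast; omega), shiftedRoots_succ]
    exact interlaces_diffOp_factorPoly shiftedRoots_ne_zero n
  have hsimple : ∀ n N : ℕ, K ≤ n → (n : ℤ) + α = K + N →
      SimpleOff (n - (shiftedRoots (assocPoly K γ) N).card) (laguerreComb (α : ℝ) K γ n) ∧
        (laguerreComb (α : ℝ) K γ n).natDegree = n := by
    intro n N hn hN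
    rw [hq n N hn hN, natDegree_diffOp_factorPoly, natDegree_expTerm]
    exact ⟨(simpleOff_expTerm n).diffOp_factorPoly shiftedRoots_ne_zero, rfl⟩
  have hnonneg : ∀ n N : ℕ, K ≤ n → (n : ℤ) + α = K + N → numZerosGtOne (assocPoly K γ) = 0 →
      (∀ x ∈ realZeros (laguerreComb (α : ℝ) K γ n), 0 ≤ x) ∧
        (laguerreComb (α : ℝ) K γ n).rootMultiplicity 0 =
          n - (shiftedRoots (assocPoly K γ) N).card := by
    intro n N hn hN h0
    rw [hq n N hn hN]
    have h1 : ∀ b ∈ shiftedRoots (assocPoly K γ) N, (1 : ℝ) * b ≤ 0 := by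
      intro b hb
      have h2 := hpos N
      rw [h0, Multiset.card_eq_zero, Multiset.filter_eq_nil] at h2
      simpa using h2 b hb
    have h2 := roots_nonneg_diffOp_factorPoly (one_pow 2) shiftedRoots_ne_zero h1 n
    exact ⟨fun x hx => by simpa using h2.1 x (Multiset.mem_toFinset.1 hx), h2.2⟩
  have hlarge : ∀ n N : ℕ, K ≤ n → (n : ℤ) + α = K + N → α < (s : ℤ) →
      (((laguerreComb (α : ℝ) K γ n).rootMultiplicity 0 : ℕ) : ℤ) = -α + (s : ℤ) ∧
      ((((realZeros (laguerreComb (α : ℝ) K γ n)).erase 0).card : ℕ) : ℤ) =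
        (n : ℤ) + α - (s : ℤ) ∧
      (∀ x ∈ (realZeros (laguerreComb (α : ℝ) K γ n)).erase 0,
        (laguerreComb (α : ℝ) K γ n).rootMultiplicity x = 1) := by
    intro n N hn hN hs
    obtain ⟨h1, h2⟩ := hsimple n N hn hN
    have h3 := h1.card_realZeros_erase
    have h4 := h1.mult
    have h5 := hcard N
    -- Here n minus the number of factors is s - α > 0, which rules out the ambiguous alternative in
    -- `SimpleOff.mult`.
    refine ⟨by omega, by omega, fun x hx => ?_⟩
    exact h1.rootMultiplicity_eq_one (Or.inl (Finset.ne_of_mem_erase hx))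
      (Finset.mem_of_mem_erase hx)
  refine ⟨fun hα n hn => ?_, fun hα => ?_, ?_⟩
  · obtain ⟨N, hN⟩ : ∃ N : ℕ, (n : ℤ) + α = K + N := ⟨((n : ℤ) + α - K).toNat, by omega⟩
    have h5 := hcard N
    refine ⟨fun hs => ?_, fun hs => ?_, hinter n N hn hN⟩
    · obtain ⟨h1, h2⟩ := hsimple n N hn hN
      have h6 : n - (shiftedRoots (assocPoly K γ) N).card = 0 := by omega
      rw [h6] at h1
      refine ⟨by rw [h1.card_realZeros, h2],
        fun x hx => h1.rootMultiplicity_eq_one (Or.inr rfl) hx, fun h0 x hx => ?_⟩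
      obtain ⟨h7, h8⟩ := hnonneg n N hn hN h0
      refine lt_of_le_of_ne (h7 x hx) ?_
      -- A zero at 0 would be simple, but its multiplicity is n minus the number of factors,
      -- truncated to 0.
      rintro rfl
      have := h1.rootMultiplicity_eq_one (Or.inr rfl) hx
      omega
    · obtain ⟨h1, h2, h3⟩ := hlarge n N hn hN hs
      refine ⟨h1, h2, h3, fun h0 x hx => ?_⟩
      exact lt_of_le_of_ne ((hnonneg n N hn hN h0).1 x (Finset.mem_of_mem_erase hx))
        (Finset.ne_of_mem_erase hx).symm
  -- Largeness of n serves only to make N = n + α - K nonnegative; α < s is automatic.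
  · filter_upwards [eventually_ge_atTop (K + α.natAbs)] with n hn
    obtain ⟨N, hN⟩ : ∃ N : ℕ, (n : ℤ) + α = K + N := ⟨((n : ℤ) + α - K).toNat, by omega⟩
    obtain ⟨h1, h2, h3⟩ := hlarge n N (by omega) hN (by omega)
    exact ⟨h1, h2, h3, hinter n N (by omega) hN⟩
  · obtain ⟨N₀, hN₀⟩ := hneg
    filter_upwards [eventually_ge_atTop (K + α.natAbs + N₀)] with n hn
    obtain ⟨N, hN⟩ : ∃ N : ℕ, (n : ℤ) + α = K + N := ⟨((n : ℤ) + α - K).toNat, by omega⟩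
    rw [hq n N (by omega) hN]
    exact hN₀ n N (by omega) hN

end
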